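/- Let $k$ be a field of characteristic $0$ (for example $k=\overline{\mathbb Q}_\ell$). Let $G$ be a Hausdorff, locally compact, totally disconnected topological group with center $Z$, and write $C_G(g)$ for the centralizer of $g\in G$. For a subgroup $J\subset G$ let $n_J(g)\in\{0,1,2,\dots\}\cup\{+\infty\}$ be the number of right cosets $Jx$ of $J$ in $G$ such that $xgx^{-1}\in J$. **(a)** Let $J\subset G$ be an open subgroup such that $Z\subset J$ and $J/Z$ is compact, and let $\sigma$ be a smooth finite dimensional representation of $J$ over $k$ such that the compactly induced representation $\rho=\text{c-Ind}_J^G(\sigma)$ is admissible. (Here $\rho$ acts by right translation on the space of functions $f:G\to\sigma$ with $f(jx)=\sigma(j)f(x)$ for $j\in J$, $x\in G$, which are right invariant under some open subgroup of $G$ and whose support is contained in $J\cdot C$ for some compact $C\subset G$; a representation of $G$ is smooth if each vector is fixed by an open subgroup, and admissible if it is smooth and for every compact open subgroup the space of fixed vectors is finite dimensional.) Let $\mu$ be a left Haar measure on $G$ with values in $k$, i.e. a nonzero finitely additive left invariant $k$-valued function on the compact open subsets of $G$. Let $g\in G$ be such that $C_G(g)/Z$ is compact, $n_J(g)<\infty$,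 and there is an open neighborhood $U$ of $g$ in $G$ with $n_J(y)=n_J(g)$ for all $y\in U$. Then for every open subgroup $N'\subset G$ there exists a compact open subgroup $N\subset N'$ such that $\mu(N)\neq 0$, the operator $\int_{z\in N}\rho(gz)\,d\mu(z)$ has finite rank, and $$\frac{1}{\mu(N)}\cdot\operatorname{tr}\left(\int_{z\in N}\rho(gz)\,d\mu(z)\right)=\sum_{x\in J\backslash G,\ xgx^{-1}\in J}\operatorname{tr}\bigl(\sigma(xgx^{-1})\bigr).$$ **(b)** Let $F$ be a nondiscrete locally compact non-Archimedean field, let $n\ge 0$ be an integer, and let $G=GL_n(F)$, which is a Hausdorff, locally compact, totally disconnected group. Let $J\subset G$ be an open subgroup such that $Z\subset J$ and $J/Z$ is compact. Then every regular elliptic $g\in G$ (i.e. one whose characteristic polynomial is separable and irreducible over $F$) satisfies the assumptions of (a): $C_G(g)/Z$ is compact, $n_J(g)<\infty$, and $n_J$ is constant on an open neighborhood of $g$ in $G$. -/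

import Mathlib

open scoped Pointwise Topology

noncomputable section

namespace FrobChar

/-! ### Smooth and admissible representations -/

section Representations

variable {k G V : Type*} [Field k] [Group G] [TopologicalSpace G] [AddCommGroup V] [Module k V]

/-- A representation is smooth if every vector is fixed by an open subgroup. -/
def IsSmooth (π : Representation k G V) : Prop :=
  ∀ v : V, ∃ U : Subgroup G, IsOpen (U : Set G) ∧ ∀ u ∈ U, π u v = v

/-- A representation is admissible if it is smooth and the space of vectors fixed by any compact
open subgroup is finite dimensional. -/
def IsAdmissible (π : Representation k G V) : Prop :=
  IsSmooth π ∧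
    ∀ K : Subgroup G, IsOpen (K : Set G) → IsCompact (K : Set G) →
      FiniteDimensional k (Representation.invariants (π.comp K.subtype))

end Representations

/-! ### Compact induction -/

section CompactInduction

variable {k G W : Type*} [Field k] [Group G] [TopologicalSpace G] [IsTopologicalGroup G]
  [AddCommGroup W] [Module k W]

/-- The space of `c-Ind_J^G σ`: functions `f : G → W` such that `f (j x) = σ j (f x)` for `j ∈ J`,
which are invariant under right translation by some open subgroup, and whose support is compact
modulo `J`, i.e. contained in `J * C` with `C` compact. -/
def cIndSpace (J : Subgroup G) (σ : Representation k J W) : Submodule k (G → W) where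
  carrier := {f |
    (∀ (j : J) (x : G), f ((j : G) * x) = σ j (f x)) ∧
    (∃ U : Subgroup G, IsOpen (U : Set G) ∧ ∀ x : G, ∀ u ∈ U, f (x * u) = f x) ∧
    (∃ C : Set G, IsCompact C ∧ Function.support f ⊆ (J : Set G) * C)}
  add_mem' := by
    rintro f₁ f₂ ⟨h₁, ⟨U₁, hU₁, hf₁⟩, C₁, hC₁, hs₁⟩ ⟨h₂, ⟨U₂, hU₂, hf₂⟩, C₂, hC₂, hs₂⟩
    refine ⟨fun j x => by simp [h₁, h₂], ⟨U₁ ⊓ U₂, hU₁.inter hU₂, fun x u hu => ?_⟩,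
      C₁ ∪ C₂, hC₁.union hC₂, ?_⟩
    · simp [hf₁ x u hu.1, hf₂ x u hu.2]
    · rw [Set.mul_union]
      exact (Function.support_add f₁ f₂).trans (Set.union_subset_union hs₁ hs₂)
  zero_mem' := ⟨by simp, ⟨⊤, isOpen_univ, by simp⟩, ∅, isCompact_empty, by simp⟩
  smul_mem' := by
    rintro c f ⟨h, ⟨U, hU, hf⟩, C, hC, hs⟩
    refine ⟨fun j x => by simp [h], ⟨U, hU, fun x u hu => by simp [hf x u hu]⟩, C, hC, ?_⟩
    exact (Function.support_const_smul_subset c f).trans hs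

/-- The representation `c-Ind_J^G σ`: the group `G` acts on `cIndSpace J σ` by right translation,
`(g • f) x = f (x * g)`. -/
def cInd (J : Subgroup G) (σ : Representation k J W) : Representation k G (cIndSpace J σ) where
  toFun g := (LinearMap.funLeft k W (fun x : G => x * g)).restrict (by
    rintro f ⟨h, ⟨U, hU, hf⟩, C, hC, hs⟩
    refine ⟨fun j x => by simp [LinearMap.funLeft_apply, mul_assoc, h],
      ⟨U.map (MulAut.conj g).toMonoidHom, ?_, ?_⟩, C * {g⁻¹}, hC.mul isCompact_singleton, ?_⟩
    · have : ((U.map (MulAut.conj g).toMonoidHom : Subgroup G) : Set G)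
          = (fun x : G => g⁻¹ * x * g) ⁻¹' (U : Set G) := by
        ext x
        constructor
        · rintro ⟨u, hu, rfl⟩
          simpa [mul_assoc] using hu
        · intro hx
          exact ⟨g⁻¹ * x * g, hx, by simp [mul_assoc]⟩
      rw [this]
      exact hU.preimage (by fun_prop)
    · rintro x _ ⟨u, hu, rfl⟩
      have := hf (x * g) u hu
      simpa [LinearMap.funLeft_apply, mul_assoc] using this
    · intro x hx
      have hx' : x * g ∈ (J : Set G) * C := hs hx
      rw [← mul_assoc]
      exact ⟨x * g, hx', g⁻¹, rfl, by simp⟩)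
  map_one' := by
    ext f x
    simp [LinearMap.funLeft_apply]
  map_mul' a b := by
    ext f x
    simp [LinearMap.funLeft_apply, mul_assoc]

end CompactInduction

/-! ### Haar measure with values in the coefficient field, integrals of smooth functions -/

section Haar

/-- A left Haar measure on a totally disconnected locally compact group `G` with values in a field
`k` of characteristic zero: a nonzero finitely additive left invariant `k`-valued function on the
compact open subsets of `G` (its values on other subsets are irrelevant and never used). -/
structure LeftHaarMeasure (k G : Type*) [Field k] [Group G] [TopologicalSpace G] where
  toFun : Set G → k
  map_union : ∀ A B : Set G, IsCompact A → IsOpen A → IsCompact B → IsOpen B → Disjoint A B →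
    toFun (A ∪ B) = toFun A + toFun B
  map_smul : ∀ (g : G) (A : Set G), IsCompact A → IsOpen A → toFun (g • A) = toFun A
  exists_ne_zero : ∃ A : Set G, IsCompact A ∧ IsOpen A ∧ toFun A ≠ 0

variable {k G V : Type*} [Field k] [Group G] [TopologicalSpace G] [AddCommGroup V] [Module k V]

/-- The integral `∫_{z ∈ S} φ z dμ(z)` of a locally constant vector-valued function `φ` over a
compact open set `S`: the finite sum over the values `w` of `φ` of `μ {z ∈ S | φ z = w} • w`. -/
def LeftHaarMeasure.integral (μ : LeftHaarMeasure k G) (S : Set G) (φ : G → V) : V :=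
  ∑ᶠ w : V, μ.toFun (S ∩ φ ⁻¹' {w}) • w

/-- The trace of an endomorphism of finite rank of a possibly infinite dimensional vector space:
the trace of its restriction to its range. -/
def finiteRankTrace (T : V →ₗ[k] V) : k :=
  LinearMap.trace k (LinearMap.range T) (T.restrict fun x _ => LinearMap.mem_range_self T x)

end Haar

/-! ### The two sides of the Frobenius formula -/

section Cosets

variable {k G W : Type*} [Field k] [Group G] [AddCommGroup W] [Module k W]

/-- The set of right cosets `J x` of `J` in `G` such that `x * g * x⁻¹ ∈ J`. -/
def fixedCosets (J : Subgroup G) (g : G) : Set (Quotient (QuotientGroup.rightRel J)) :=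
  Quotient.mk (QuotientGroup.rightRel J) '' {x : G | x * g * x⁻¹ ∈ J}

/-- The number `n_J(g)` of right cosets `J x` such that `x * g * x⁻¹ ∈ J`; it may be infinite. -/
def cosetCount (J : Subgroup G) (g : G) : ℕ∞ := (fixedCosets J g).encard

open Classical in
/-- `tr σ(x g x⁻¹)` if `x * g * x⁻¹ ∈ J`, and `0` otherwise. -/
def conjTrace (J : Subgroup G) (σ : Representation k J W) (g x : G) : k :=
  if h : x * g * x⁻¹ ∈ J then LinearMap.trace k W (σ ⟨x * g * x⁻¹, h⟩) else 0

/-- `conjTrace` depends only on the right coset `J x`. -/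
theorem conjTrace_eq_of_rel (J : Subgroup G) (σ : Representation k J W) (g : G) (x y : G)
    (h : (QuotientGroup.rightRel J) x y) : conjTrace J σ g x = conjTrace J σ g y := by
  have hj : y * x⁻¹ ∈ J := QuotientGroup.rightRel_apply.1 h
  obtain ⟨j, rfl⟩ : ∃ j : J, y = j * x := ⟨⟨y * x⁻¹, hj⟩, by simp⟩
  have key : (j : G) * x * g * ((j : G) * x)⁻¹ = j * (x * g * x⁻¹) * (j : G)⁻¹ := by group
  unfold conjTrace
  by_cases hx : x * g * x⁻¹ ∈ J
  · have hy : (j : G) * x * g * ((j : G) * x)⁻¹ ∈ J := by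
      rw [key]; exact J.mul_mem (J.mul_mem j.2 hx) (J.inv_mem j.2)
    rw [dif_pos hx, dif_pos hy]
    have e : (⟨(j : G) * x * g * ((j : G) * x)⁻¹, hy⟩ : J) = j * ⟨x * g * x⁻¹, hx⟩ * j⁻¹ :=
      Subtype.ext key
    rw [e, map_mul, LinearMap.trace_mul_comm, ← map_mul]
    simp
  · have hy : (j : G) * x * g * ((j : G) * x)⁻¹ ∉ J := by
      intro hy
      apply hx
      have := J.mul_mem (J.mul_mem (J.inv_mem j.2) hy) j.2
      rw [key] at this
      simpa [mul_assoc] using this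
    rw [dif_neg hx, dif_neg hy]

/-- The sum of `tr σ(x g x⁻¹)` over the right cosets `J x` of `J` in `G` with
`x * g * x⁻¹ ∈ J`; meaningful if there are finitely many of them. -/
def frobeniusSum (J : Subgroup G) (σ : Representation k J W) (g : G) : k :=
  ∑ᶠ q : Quotient (QuotientGroup.rightRel J),
    Quotient.lift (conjTrace J σ g) (conjTrace_eq_of_rel J σ g) q

end Cosets

/-- An element of `GL_n(F)` is regular elliptic if its characteristic polynomial is separable and
irreducible over `F`. -/
def IsRegularElliptic {F : Type*} [Field F] {n : ℕ} (g : GL (Fin n) F) : Prop :=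
  (g : Matrix (Fin n) (Fin n) F).charpoly.Separable ∧
    Irreducible (g : Matrix (Fin n) (Fin n) F).charpoly

section GroupHypotheses

variable {G : Type*} [Group G] [TopologicalSpace G]

/-- `J` is an open subgroup which contains the center `Z` of `G` and is compact modulo `Z`. -/
def IsOpenCompactModCenter (J : Subgroup G) : Prop :=
  IsOpen (J : Set G) ∧ Subgroup.center G ≤ J ∧
    CompactSpace (J ⧸ (Subgroup.center G).subgroupOf J)

/-- The conditions on `g`: its centralizer is compact modulo the center, and `n_J` is finite at `g`
and constant on a neighborhood of `g`. -/
def IsGoodElement (J : Subgroup G) (g : G) : Prop :=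
  CompactSpace (Subgroup.centralizer {g} ⧸
    (Subgroup.center G).subgroupOf (Subgroup.centralizer {g})) ∧
  cosetCount J g < ⊤ ∧
  ∃ U : Set G, IsOpen U ∧ g ∈ U ∧ ∀ y ∈ U, cosetCount J y = cosetCount J g

end GroupHypotheses

end FrobChar

end

/-! Part (a): `c-Ind` is a direct sum of copies of `σ`, one for each right coset `Jx`, and `ρ(y)`
permutes these summands by right translation of cosets. The diagonal block of `ρ(y)` at `Jx` is
therefore `σ(xyx⁻¹)` if `xyx⁻¹ ∈ J`, and zero otherwise. For small `N`, the block of `∫ρ(gz)` at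
`Jx` should be `μ(N)` times the block of `ρ(g)`. At the finitely many cosets fixed by `g` this holds
once `xzx⁻¹ ∈ ker σ` for all `z ∈ N`. These cosets are then fixed by `gz` as well, and since
`n_J(gz) = n_J(g)` there are no others (`exists_compact_open_subgroup_fixedCosets_eq`).
Admissibility makes the operator of finite rank, because its image lies in `ρ(g)` of the
`N`-invariants. Its trace is the sum of its diagonal blocks (`finiteRankTrace_eq_sum_trace`), and
`μ(N) ≠ 0` because `k` has characteristic zero.

Part (b): everything follows once the `x` conjugating elements near `g` into `J` are compact modulo
the center (`exists_isCompact_of_conj_mem`). Write `J ⊂ Z·C₀` with `C₀` compact, so that `xy = d c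
x` with `c ∈ C₀` and `d` a scalar. Rescale `x` into a compact set of nonzero matrices; then `d` is
bounded, and the solutions `(x, y, c, d)` with `y` near `g` form a compact set. The only danger is
that `x` degenerates to a singular matrix. For `y = g` this is excluded, since the kernel of `x` is
stable under `g`, whose characteristic polynomial is irreducible (`det_ne_zero_of_intertwines`). By
compactness it is excluded for all `y` close to `g`. -/

namespace FrobChar

/-! ### Cosets, centralizers and compact open subgroups. -/

section TopologicalGroups

variable {G : Type*} [Group G] [TopologicalSpace G] [IsTopologicalGroup G]

/-- A compact set meets only finitely many right cosets of an open subgroup. -/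
theorem finite_image_mk_of_isCompact {J : Subgroup G} (hJ : IsOpen (J : Set G)) {C : Set G}
    (hC : IsCompact C) : (Quotient.mk (QuotientGroup.rightRel J) '' C).Finite := by
  obtain ⟨t, -, ht⟩ := hC.elim_nhds_subcover (fun x => (fun y => y * x⁻¹) ⁻¹' (J : Set G))
    (fun x _ => (hJ.preimage (by fun_prop)).mem_nhds (by simp))
  refine (t.finite_toSet.image (Quotient.mk (QuotientGroup.rightRel J))).subset ?_
  rintro _ ⟨y, hy, rfl⟩
  obtain ⟨x, hx, hxy⟩ := Set.mem_iUnion₂.1 (ht hy)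
  exact ⟨x, hx, Quotient.sound (QuotientGroup.rightRel_apply.2 hxy)⟩

/-- A locally compact group which is compact modulo a subgroup `N` is the product of a compact
set and `N`. -/
theorem exists_isCompact_of_compactSpace_quotient [LocallyCompactSpace G] (N : Subgroup G)
    [CompactSpace (G ⧸ N)] : ∃ C : Set G, IsCompact C ∧ ∀ x : G, ∃ c ∈ C, x⁻¹ * c ∈ N := by
  obtain ⟨K, hK, hK1⟩ := exists_compact_mem_nhds (1 : G)
  obtain ⟨t, ht⟩ := (isCompact_univ : IsCompact (Set.univ : Set (G ⧸ N))).elim_finite_subcover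
    (fun x : G => (QuotientGroup.mk : G → G ⧸ N) '' (x • interior K))
    (fun x => QuotientGroup.isOpenMap_coe _ (isOpen_interior.smul x))
    (fun q _ => by
      obtain ⟨x, rfl⟩ := QuotientGroup.mk_surjective q
      exact Set.mem_iUnion.2 ⟨x, x, ⟨1, mem_interior_iff_mem_nhds.2 hK1, by simp⟩, rfl⟩)
  refine ⟨⋃ x ∈ t, x • K, t.isCompact_biUnion fun x _ => hK.smul x, fun x => ?_⟩
  obtain ⟨a, ha, c, hc, hcx⟩ := Set.mem_iUnion₂.1 (ht (Set.mem_univ (x : G ⧸ N)))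
  exact ⟨c, Set.mem_iUnion₂.2 ⟨a, ha, Set.smul_set_mono interior_subset hc⟩,
    QuotientGroup.eq.1 hcx.symm⟩

/-- The form in which compactness of `J/Z` enters the estimate for elliptic elements. -/
theorem exists_isCompact_of_isOpenCompactModCenter [LocallyCompactSpace G] {J : Subgroup G}
    (hJ : IsOpenCompactModCenter J) :
    ∃ C : Set G, IsCompact C ∧ ∀ x ∈ J, ∃ z ∈ Subgroup.center G, ∃ c ∈ C, x = z * c := by
  obtain ⟨hJo, -, hJc⟩ := hJ
  have : LocallyCompactSpace J := hJo.isOpenEmbedding_subtypeVal.locallyCompactSpace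
  obtain ⟨C, hC, h⟩ := exists_isCompact_of_compactSpace_quotient
    ((Subgroup.center G).subgroupOf J)
  refine ⟨Subtype.val '' C, hC.image continuous_subtype_val, fun x hx => ?_⟩
  obtain ⟨c, hc, hz⟩ := h ⟨x, hx⟩
  rw [Subgroup.mem_subgroupOf] at hz
  refine ⟨_, inv_mem hz, c, ⟨c, hc, rfl⟩, ?_⟩
  rw [(Subgroup.mem_center_iff.1 (inv_mem hz) c).symm]
  simp

omit [TopologicalSpace G] [IsTopologicalGroup G] in
/-- A coset lies in `fixedCosets` if and only if its chosen representative conjugates into `J`. -/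
theorem mk_mem_fixedCosets_iff {J : Subgroup G} {g x : G} :
    Quotient.mk (QuotientGroup.rightRel J) x ∈ fixedCosets J g ↔ x * g * x⁻¹ ∈ J := by
  refine ⟨?_, fun h => ⟨x, h, rfl⟩⟩
  rintro ⟨y, hy, hyx⟩
  have hj : x * y⁻¹ ∈ J := QuotientGroup.rightRel_apply.1 (Quotient.exact hyx)
  have : x * g * x⁻¹ = (x * y⁻¹) * (y * g * y⁻¹) * (x * y⁻¹)⁻¹ := by group
  rw [this]
  exact J.mul_mem (J.mul_mem hj hy) (J.inv_mem hj)

omit [TopologicalSpace G] [IsTopologicalGroup G] in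
theorem mem_fixedCosets_iff {J : Subgroup G} {g : G} {q : Quotient (QuotientGroup.rightRel J)} :
    q ∈ fixedCosets J g ↔ q.out * g * q.out⁻¹ ∈ J := by
  rw [← mk_mem_fixedCosets_iff, Quotient.out_eq]

theorem isOpen_setOf_conj_mem {J : Subgroup G} (hJ : IsOpen (J : Set G)) (x : G) :
    IsOpen {y : G | x * y * x⁻¹ ∈ J} :=
  hJ.preimage (f := fun y => x * y * x⁻¹) (by fun_prop)

/-- If the elements conjugating some `y` near `g` into `J` lie in a common set which is compact
modulo the center, then `cosetCount J` is finite at `g` and constant near `g`. -/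
theorem cosetCount_locally_constant {J : Subgroup G} (hJ : IsOpen (J : Set G))
    (hZ : Subgroup.center G ≤ J) {g : G} {U C : Set G} (hU : IsOpen U) (hgU : g ∈ U)
    (hC : IsCompact C)
    (h : ∀ y ∈ U, ∀ x : G, x * y * x⁻¹ ∈ J → ∃ z ∈ Subgroup.center G, z * x ∈ C) :
    cosetCount J g < ⊤ ∧
      ∃ U : Set G, IsOpen U ∧ g ∈ U ∧ ∀ y ∈ U, cosetCount J y = cosetCount J g := by
  have hF := finite_image_mk_of_isCompact hJ hC
  set F := Quotient.mk (QuotientGroup.rightRel J) '' C with hFdef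
  have hsub : ∀ y ∈ U, fixedCosets J y ⊆ F := by
    rintro y hy _ ⟨x, hx, rfl⟩
    obtain ⟨z, hz, hzx⟩ := h y hy x hx
    refine ⟨_, hzx, Quotient.sound (QuotientGroup.rightRel_apply.2 ?_)⟩
    simpa using J.inv_mem (hZ hz)
  -- Cosets outside the finite set `F` are fixed by no element of `U`. For each coset in `F`, being
  -- fixed is a clopen condition on `y`, as open subgroups are closed.
  refine ⟨?_, U ∩ ⋂ q ∈ F, {y | q.out * y * q.out⁻¹ ∈ J ↔ q.out * g * q.out⁻¹ ∈ J}, ?_, ?_, ?_⟩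
  · exact Set.encard_lt_top_iff.2 (hF.subset (hsub g hgU))
  · refine hU.inter (hF.isOpen_biInter fun q _ => ?_)
    by_cases hq : q.out * g * q.out⁻¹ ∈ J
    · simpa [hq] using isOpen_setOf_conj_mem hJ q.out
    · simp only [hq, iff_false]
      exact ((Subgroup.isClosed_of_isOpen _ hJ).preimage
        (f := fun y => q.out * y * q.out⁻¹) (by fun_prop)).isOpen_compl
  · exact ⟨hgU, Set.mem_iInter₂.2 fun q _ => Iff.rfl⟩
  · rintro y ⟨hyU, hy⟩
    have : fixedCosets J y = fixedCosets J g := by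
      ext q
      by_cases hq : q ∈ F
      · rw [mem_fixedCosets_iff, mem_fixedCosets_iff]
        exact Set.mem_iInter₂.1 hy q hq
      · exact ⟨fun h => (hq (hsub y hyU h)).elim, fun h => (hq (hsub g hgU h)).elim⟩
    rw [cosetCount, this, cosetCount]

/-- The centralizer of `g` is compact modulo the center if it is covered by the translates of a
compact set by the center. -/
theorem compactSpace_centralizer_quotient [T2Space G] {g : G} {C : Set G} (hC : IsCompact C)
    (h : ∀ x : G, x * g * x⁻¹ = g → ∃ z ∈ Subgroup.center G, z * x ∈ C) :
    CompactSpace (Subgroup.centralizer {g} ⧸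
      (Subgroup.center G).subgroupOf (Subgroup.centralizer {g})) := by
  have hcl : IsClosed ((Subgroup.centralizer {g} : Subgroup G) : Set G) := by
    have : ((Subgroup.centralizer {g} : Subgroup G) : Set G) = {x | g * x = x * g} := by
      ext x
      simp [Subgroup.mem_centralizer_iff]
    rw [this]
    exact isClosed_eq (by fun_prop) (by fun_prop)
  have hK := (hcl.isClosedEmbedding_subtypeVal.isCompact_preimage hC).image
    (QuotientGroup.continuous_mk
      (N := (Subgroup.center G).subgroupOf (Subgroup.centralizer {g})))
  refine ⟨?_⟩
  convert hK
  refine (Set.eq_univ_of_forall fun q => ?_).symm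
  obtain ⟨⟨x, hx⟩, rfl⟩ := QuotientGroup.mk_surjective q
  have hx' := Subgroup.mem_centralizer_iff.1 hx g rfl
  obtain ⟨z, hz, hzx⟩ := h x (by rw [← hx']; group)
  have hzc : z ∈ Subgroup.centralizer {g} := Subgroup.center_le_centralizer _ hz
  refine ⟨⟨z, hzc⟩ * ⟨x, hx⟩, hzx, QuotientGroup.eq.2 ?_⟩
  rw [Subgroup.mem_subgroupOf]
  have := Subgroup.mem_center_iff.1 (inv_mem hz) x
  simp [mul_assoc, ← this, inv_mem hz]

/-- The left stabilizer of a compact open set is open. -/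
theorem isOpen_stabilizer_of_isCompact {A : Set G} (hA : IsCompact A) (hA' : IsOpen A) :
    IsOpen (MulAction.stabilizer G A : Set G) := by
  have h : ∀ᶠ x in 𝓝 (1 : G), ∀ a ∈ A, x * a ∈ A := by
    refine hA.eventually_forall_of_forall_eventually fun a ha => ?_
    exact (continuous_mul.tendsto ((1 : G), a)).eventually (hA'.mem_nhds (by simpa using ha))
  have h' : ∀ᶠ x in 𝓝 (1 : G), ∀ a ∈ A, x⁻¹ * a ∈ A :=
    (tendsto_inv (1 : G)).eventually (by simpa using h)
  refine Subgroup.isOpen_of_mem_nhds _ (g := 1) ?_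
  filter_upwards [h, h'] with x hx hx'
  refine MulAction.mem_stabilizer_iff.2 (Set.Subset.antisymm ?_ fun a ha => ?_)
  · rintro _ ⟨a, ha, rfl⟩
    exact hx a ha
  · exact ⟨x⁻¹ * a, hx' a ha, by simp⟩

variable [T2Space G] [LocallyCompactSpace G] [TotallyDisconnectedSpace G]

/-- Van Dantzig's theorem: the compact open subgroups form a neighborhood basis of `1`. -/
theorem exists_compact_open_subgroup_subset {U : Set G} (hU : IsOpen U) (h1 : (1 : G) ∈ U) :
    ∃ N : Subgroup G, IsOpen (N : Set G) ∧ IsCompact (N : Set G) ∧ (N : Set G) ⊆ U := by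
  obtain ⟨K, hK1, hKU, hK⟩ := local_compact_nhds (hU.mem_nhds h1)
  obtain ⟨V, hV, h1V, hVK⟩ := loc_compact_Haus_tot_disc_of_zero_dim.mem_nhds_iff.1 hK1
  have hVc : IsCompact V := hK.of_isClosed_subset hV.isClosed hVK
  -- The subgroup is the left stabilizer of the compact open set `V`; it lies in `V` because `1 ∈
  -- V`.
  have ho := isOpen_stabilizer_of_isCompact hVc hV.isOpen
  have hsub : (MulAction.stabilizer G V : Set G) ⊆ V := fun x hx => by
    rw [← MulAction.mem_stabilizer_iff.1 hx]
    exact ⟨1, h1V, by simp⟩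
  exact ⟨_, ho, hVc.of_isClosed_subset (Subgroup.isClosed_of_isOpen _ ho) hsub,
    hsub.trans (hVK.trans hKU)⟩

end TopologicalGroups

/-! ### Regular elliptic elements of `GL_n(F)`. -/

section GeneralLinear

open scoped Matrix

variable {F : Type*} [NontriviallyNormedField F] {n : ℕ}

/-- The invertible matrices with entries in a compact set of matrices on which the determinant
does not vanish form a compact subset of `GL n F`. -/
theorem isCompact_preimage_val_of_det_ne_zero {K : Set (Matrix (Fin n) (Fin n) F)}
    (hK : IsCompact K) (hdet : ∀ x ∈ K, x.det ≠ 0) :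
    IsCompact ((Units.val : GL (Fin n) F → Matrix (Fin n) (Fin n) F) ⁻¹' K) := by
  -- The topology on units is induced from pairs `(x, x⁻¹)`, so the inverses must stay in a compact
  -- set too.
  have hL : IsCompact ((fun x : Matrix (Fin n) (Fin n) F => x⁻¹) '' K) := by
    refine hK.image_of_continuousOn ?_
    have : ContinuousOn (fun x : Matrix (Fin n) (Fin n) F => (x.det)⁻¹ • x.adjugate) K :=
      ContinuousOn.smul ((continuous_id.matrix_det.continuousOn).inv₀ hdet)
        continuous_id.matrix_adjugate.continuousOn
    refine this.congr fun x _ => ?_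
    simp only [Matrix.inv_def, Ring.inverse_eq_inv']
  have hP := Units.isClosedEmbedding_embedProduct.isCompact_preimage
    (hK.prod (hL.image MulOpposite.continuous_op))
  convert hP
  ext x
  simp only [Set.mem_preimage, Units.embedProduct_apply, Set.mem_prod]
  refine ⟨fun h => ⟨h, _, ⟨_, h, rfl⟩, ?_⟩, fun h => h.1⟩
  simp

/-- A nonzero matrix which intertwines a matrix with irreducible characteristic polynomial with
another matrix is invertible. -/
theorem det_ne_zero_of_intertwines {K : Type*} [Field K] {n : ℕ}
    {x y c : Matrix (Fin n) (Fin n) K}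
    (hy : Irreducible y.charpoly) (hx : x ≠ 0) (h : x * y = c * x) : x.det ≠ 0 := by
  intro hdet
  obtain ⟨v, hv, hxv⟩ := Matrix.exists_mulVec_eq_zero_iff.2 hdet
  -- Hence `x` kills `q(y)v` for every `q` as soon as it kills `v`; it remains to see that `v` is a
  -- cyclic vector for `y`.
  have hcomm : ∀ q : Polynomial K, x * Polynomial.aeval y q = Polynomial.aeval c q * x := by
    intro q
    induction q using Polynomial.induction_on' with
    | add p q hp hq => simp [mul_add, add_mul, hp, hq]
    | monomial m a =>
      have : x * y ^ m = c ^ m * x := SemiconjBy.pow_right (a := x) (x := y) (y := c) h m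
      simp [Polynomial.aeval_monomial, Algebra.algebraMap_eq_smul_one, this]
  let φ : Polynomial.degreeLT K n →ₗ[K] (Fin n → K) :=
    { toFun := fun q => Polynomial.aeval y (q : Polynomial K) *ᵥ v
      map_add' := fun p q => by simp [Matrix.add_mulVec]
      map_smul' := fun a q => by simp [Matrix.smul_mulVec] }
  have hinj : Function.Injective φ := by
    rw [injective_iff_map_eq_zero]
    intro q hq
    by_contra hq0
    have hq0' : (q : Polynomial K) ≠ 0 := fun h0 => hq0 (Subtype.ext h0)
    have hcop : IsCoprime y.charpoly (q : Polynomial K) := by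
      refine hy.coprime_iff_not_dvd.2 fun hdvd => ?_
      have h1 := Polynomial.degree_le_of_dvd hdvd hq0'
      have h2 := Polynomial.mem_degreeLT.1 q.2
      rw [Matrix.charpoly_degree_eq_dim, Fintype.card_fin] at h1
      exact absurd (h1.trans_lt h2) (lt_irrefl _)
    obtain ⟨a, b, hab⟩ := hcop
    have := congrArg (fun r => Polynomial.aeval y r *ᵥ v) hab
    simp only [map_add, map_mul, Matrix.aeval_self_charpoly, mul_zero, zero_add,
      ← Matrix.mulVec_mulVec, map_one, Matrix.one_mulVec] at this
    have hq' : Polynomial.aeval y (q : Polynomial K) *ᵥ v = 0 := hq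
    rw [hq', Matrix.mulVec_zero] at this
    exact hv this.symm
  -- Both sides have dimension `n`, so injectivity makes `v` cyclic.
  have hsurj : Function.Surjective φ := by
    have : FiniteDimensional K (Polynomial.degreeLT K n) :=
      Module.Finite.equiv (Polynomial.degreeLTEquiv K n).symm
    exact (LinearMap.injective_iff_surjective_of_finrank_eq_finrank
      (Polynomial.degreeLTEquiv K n).finrank_eq).1 hinj
  refine hx (Matrix.ext_of_mulVec_single fun i => ?_)
  obtain ⟨q, hq⟩ := hsurj (Pi.single i 1)
  have hq' : Polynomial.aeval y (q : Polynomial K) *ᵥ v = Pi.single i 1 := hq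
  rw [← hq', Matrix.mulVec_mulVec, hcomm, ← Matrix.mulVec_mulVec, hxv]
  simp

/-- Every nonzero matrix can be rescaled into a fixed compact set which avoids zero. -/
theorem exists_isCompact_rescale (F : Type*) [NontriviallyNormedField F] [LocallyCompactSpace F]
    (n : ℕ) : ∃ S : Set (Matrix (Fin n) (Fin n) F), IsCompact S ∧ 0 ∉ S ∧
      ∀ x : Matrix (Fin n) (Fin n) F, x ≠ 0 → ∃ d : F, d ≠ 0 ∧ d • x ∈ S := by
  obtain ⟨c, hc⟩ := NormedField.exists_one_lt_norm F
  have : ProperSpace F := .of_locallyCompactSpace F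
  -- Scalar multiplication by powers of `c` brings any nonzero norm into the shell from `1/‖c‖` to
  -- `1`.
  let S : Set (Fin n → Fin n → F) := Metric.closedBall 0 1 ∩ {x | 1 / ‖c‖ ≤ ‖x‖}
  have hS : IsCompact S := (isCompact_closedBall _ _).inter_right
    (isClosed_le continuous_const continuous_norm)
  refine ⟨S, hS, ?_, fun x hx => ?_⟩
  · rintro ⟨-, h⟩
    have h' : 1 / ‖c‖ ≤ ‖(0 : Fin n → Fin n → F)‖ := h
    rw [norm_zero] at h'
    have : 0 < 1 / ‖c‖ := by positivity
    linarith
  · obtain ⟨d, hd, h1, h2, -⟩ := rescale_to_shell (F := Fin n → Fin n → F) hc one_pos hx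
    exact ⟨d, hd, (mem_closedBall_zero_iff (E := Fin n → Fin n → F)).2 h1.le, h2⟩

/-- The scalars which move a vector of a compact set avoiding zero into another compact set are
bounded. -/
theorem exists_norm_le_of_smul_mem {𝕜 E : Type*} [NormedField 𝕜] [NormedAddCommGroup E]
    [NormedSpace 𝕜 E] {S M : Set E} (hS : IsCompact S) (h0 : 0 ∉ S) (hM : IsCompact M) :
    ∃ r : ℝ, ∀ d : 𝕜, ∀ x ∈ S, d • x ∈ M → ‖d‖ ≤ r := by
  rcases S.eq_empty_or_nonempty with rfl | hne
  · exact ⟨0, by simp⟩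
  obtain ⟨x₀, hx₀, hmin⟩ := hS.exists_isMinOn hne continuous_norm.continuousOn
  obtain ⟨R, hR⟩ := hM.isBounded.exists_norm_le
  have hpos : 0 < ‖x₀‖ := norm_pos_iff.2 fun h => h0 (h ▸ hx₀)
  refine ⟨R / ‖x₀‖, fun d x hx hdx => (le_div_iff₀ hpos).2 ?_⟩
  calc ‖d‖ * ‖x₀‖ ≤ ‖d‖ * ‖x‖ := by gcongr; exact hmin hx
    _ = ‖d • x‖ := (norm_smul _ _).symm
    _ ≤ R := hR _ hdx

theorem locallyCompactSpace_GL (F : Type*) [NontriviallyNormedField F] [LocallyCompactSpace F]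
    (n : ℕ) : LocallyCompactSpace (GL (Fin n) F) := by
  have : LocallyCompactSpace (Matrix (Fin n) (Fin n) F) :=
    inferInstanceAs (LocallyCompactSpace (Fin n → Fin n → F))
  exact inferInstanceAs (LocallyCompactSpace (Matrix (Fin n) (Fin n) F)ˣ)

variable [LocallyCompactSpace F]

/-- If `g` has irreducible characteristic polynomial, the elements conjugating some `y` near `g`
into the scalar multiples of a compact set all lie in a set which is compact modulo scalars. -/
theorem exists_isCompact_of_conj_mem {g : GL (Fin n) F}
    (hg : Irreducible (g : Matrix (Fin n) (Fin n) F).charpoly) {C₀ : Set (GL (Fin n) F)}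
    (hC₀ : IsCompact C₀) :
    ∃ U C : Set (GL (Fin n) F), IsOpen U ∧ g ∈ U ∧ IsCompact C ∧
      ∀ y ∈ U, ∀ x : GL (Fin n) F,
        (∃ z ∈ Subgroup.center (GL (Fin n) F), ∃ c ∈ C₀, x * y * x⁻¹ = z * c) →
        ∃ z ∈ Subgroup.center (GL (Fin n) F), z * x ∈ C := by
  have := locallyCompactSpace_GL F n
  have : ProperSpace F := .of_locallyCompactSpace F
  -- For `n = 0` the characteristic polynomial is `1`, hence not irreducible. Nonemptiness is what
  -- makes invertible matrices nonzero below.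
  have hn : Nonempty (Fin n) := by
    by_contra hn
    rw [not_nonempty_iff] at hn
    exact hg.not_isUnit (by simp [Matrix.charpoly])
  obtain ⟨S, hS, hS0, hSx⟩ := exists_isCompact_rescale F n
  obtain ⟨B, hB, hgB⟩ := exists_compact_mem_nhds g
  -- The relation `xy = d c x` gives `c⁻¹xy = d x`, so `d x` stays in a compact set while `x ∈ S`
  -- stays away from zero; this bounds `d`.
  let ψ : Matrix (Fin n) (Fin n) F × GL (Fin n) F × GL (Fin n) F → Matrix (Fin n) (Fin n) F :=
    fun p => (p.2.2⁻¹ : GL (Fin n) F) * p.1 * p.2.1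
  have hψ : Continuous ψ := by fun_prop
  obtain ⟨r, hr⟩ := exists_norm_le_of_smul_mem (𝕜 := F) (E := Fin n → Fin n → F) hS hS0
    ((hS.prod (hB.prod hC₀)).image hψ)
  let K : Set (Matrix (Fin n) (Fin n) F × GL (Fin n) F × GL (Fin n) F × F) :=
    (S ×ˢ B ×ˢ C₀ ×ˢ Metric.closedBall 0 r) ∩
      {p | p.1 * p.2.1 = p.2.2.2 • (p.2.2.1 : Matrix (Fin n) (Fin n) F) * p.1}
  have hval : Continuous (Units.val : GL (Fin n) F → Matrix (Fin n) (Fin n) F) :=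
    Units.continuous_val
  have hK : IsCompact K := (hS.prod (hB.prod (hC₀.prod (isCompact_closedBall _ _)))).inter_right
    (isClosed_eq (by fun_prop) (by fun_prop))
  have hK₀ : IsCompact (K ∩ {p | p.1.det = 0}) :=
    hK.inter_right (isClosed_eq continuous_fst.matrix_det continuous_const)
  have hgK : g ∉ (fun p => p.2.1) '' (K ∩ {p | p.1.det = 0}) := by
    rintro ⟨⟨x, y, c, d⟩, ⟨⟨hx, h⟩, h0⟩, rfl⟩
    exact det_ne_zero_of_intertwines hg (fun h => hS0 (h ▸ hx.1)) h h0
  -- The `y` admitting a singular solution `x` form a closed set missing `g`, hence missing a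
  -- compact neighborhood `B'` of `g`.
  have hcl : IsClosed ((fun p => p.2.1) '' (K ∩ {p | p.1.det = 0})) :=
    (hK₀.image (by fun_prop)).isClosed
  obtain ⟨B', hB'n, hB's, hB'⟩ := local_compact_nhds (Filter.inter_mem hgB
    (hcl.isOpen_compl.mem_nhds hgK))
  have hK' : IsCompact (Prod.fst '' (K ∩ {p | p.2.1 ∈ B'})) :=
    (hK.inter_right (hB'.isClosed.preimage (by fun_prop))).image continuous_fst
  refine ⟨interior B', _, isOpen_interior, mem_interior_iff_mem_nhds.2 hB'n,
    isCompact_preimage_val_of_det_ne_zero hK' ?_, ?_⟩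
  · rintro _ ⟨p, ⟨hp, hpB⟩, rfl⟩ h0
    exact (hB's hpB).2 ⟨p, ⟨hp, h0⟩, rfl⟩
  · rintro y hy x ⟨z, hz, c, hc, hxy⟩
    have hyB' : y ∈ B' := interior_subset hy
    obtain ⟨d, hd⟩ := Matrix.GeneralLinearGroup.mem_center_iff_val_mem_range_scalar.1 hz
    obtain ⟨e, he0, heS⟩ := hSx x (Units.ne_zero x)
    let w : GL (Fin n) F := Matrix.GeneralLinearGroup.scalar (Fin n) (Units.mk0 e he0)
    have hw : w ∈ Subgroup.center (GL (Fin n) F) := by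
      rw [Matrix.GeneralLinearGroup.center_eq_range_scalar]
      exact ⟨_, rfl⟩
    have hwx : ((w * x : GL (Fin n) F) : Matrix (Fin n) (Fin n) F) = e • (x : Matrix _ _ F) := by
      ext i j
      simp [w, Matrix.diagonal_mul]
    have hxy' : (x : Matrix (Fin n) (Fin n) F) * y = d • (c : Matrix (Fin n) (Fin n) F) * x := by
      have h1 : x * y = z * c * x := by rw [← hxy]; group
      have h2 := congrArg (Units.val : GL (Fin n) F → Matrix (Fin n) (Fin n) F) h1
      simpa [← hd, Matrix.smul_eq_diagonal_mul] using h2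
    have hrel : (e • (x : Matrix (Fin n) (Fin n) F)) * y
        = d • (c : Matrix (Fin n) (Fin n) F) * (e • (x : Matrix (Fin n) (Fin n) F)) := by
      rw [Matrix.smul_mul, hxy', Matrix.mul_smul]
    have hdr : ‖d‖ ≤ r := by
      refine hr d _ heS ⟨(e • (x : Matrix (Fin n) (Fin n) F), y, c),
        ⟨heS, (hB's hyB').1, hc⟩, ?_⟩
      change ((c⁻¹ : GL (Fin n) F) : Matrix (Fin n) (Fin n) F)
        * (e • (x : Matrix (Fin n) (Fin n) F)) * y = d • (e • (x : Matrix (Fin n) (Fin n) F))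
      rw [mul_assoc, hrel, Matrix.smul_mul, Matrix.mul_smul, ← mul_assoc, Units.inv_mul, one_mul]
    refine ⟨w, hw, (e • (x : Matrix (Fin n) (Fin n) F), y, c, d),
      ⟨⟨⟨heS, (hB's hyB').1, hc, by simpa using hdr⟩, hrel⟩, hyB'⟩, hwx.symm⟩

/-- The compactness result is used twice: with `C₀` from `J` for the cosets, and with `C₀ = {g}` for
the centralizer. -/
theorem isGoodElement_of_isRegularElliptic {g : GL (Fin n) F} (hg : IsRegularElliptic g)
    {J : Subgroup (GL (Fin n) F)} (hJ : IsOpenCompactModCenter J) : IsGoodElement J g := by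
  have := locallyCompactSpace_GL F n
  obtain ⟨C₀, hC₀, hJC⟩ := exists_isCompact_of_isOpenCompactModCenter hJ
  obtain ⟨U, C, hU, hgU, hC, h⟩ := exists_isCompact_of_conj_mem hg.2 hC₀
  obtain ⟨U', C', hU', hgU', hC', h'⟩ := exists_isCompact_of_conj_mem hg.2
    (isCompact_singleton (x := g))
  refine ⟨compactSpace_centralizer_quotient hC' fun x hx =>
      h' g hgU' x ⟨1, one_mem _, g, rfl, by simpa using hx⟩,
    cosetCount_locally_constant hJ.1 hJ.2.1 hU hgU hC fun y hy x hx => h y hy x (hJC _ hx)⟩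

end GeneralLinear

theorem totallyDisconnectedSpace_GL (F : Type*) [NontriviallyNormedField F]
    [IsUltrametricDist F] (n : ℕ) : TotallyDisconnectedSpace (GL (Fin n) F) := by
  have : TotallyDisconnectedSpace (Matrix (Fin n) (Fin n) F) :=
    inferInstanceAs (TotallyDisconnectedSpace (Fin n → Fin n → F))
  have : TotallyDisconnectedSpace (Matrix (Fin n) (Fin n) F)ᵐᵒᵖ :=
    (MulOpposite.opHomeomorph (M := Matrix (Fin n) (Fin n) F)).totallyDisconnectedSpace
  exact Units.isEmbedding_embedProduct.isTotallyDisconnected_range.1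
    (isTotallyDisconnected_of_totallyDisconnectedSpace _)

/-! ### Traces of finite rank operators. -/

section Trace

variable {k V W : Type*} [Field k] [AddCommGroup V] [Module k V] [AddCommGroup W] [Module k W]
  [FiniteDimensional k W]

/-- The trace of an operator of finite rank is the sum of the traces of its diagonal blocks, for
any finite family of blocks which exhausts the range. -/
theorem finiteRankTrace_eq_sum_trace {ι : Type*} (s : Finset ι) (T : V →ₗ[k] V)
    [FiniteDimensional k (LinearMap.range T)] (i : ι → W →ₗ[k] V) (p : ι → V →ₗ[k] W)
    (h : ∀ v, T v = ∑ c ∈ s, i c (p c (T v))) :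
    finiteRankTrace T = ∑ c ∈ s, LinearMap.trace k W (p c ∘ₗ T ∘ₗ i c) := by
  -- On its range, `T` is the sum of `(T ∘ i c) ∘ p c`. Each summand factors through `W`, so
  -- cyclicity of the trace turns it into the block `p c ∘ T ∘ i c`.
  have key : T.restrict (fun x _ => LinearMap.mem_range_self T x)
      = ∑ c ∈ s, (T.rangeRestrict ∘ₗ i c) ∘ₗ (p c ∘ₗ (LinearMap.range T).subtype) := by
    ext ⟨_, v, rfl⟩
    simp only [LinearMap.restrict_apply, LinearMap.sum_apply, LinearMap.comp_apply,
      Submodule.subtype_apply, Submodule.coe_sum]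
    conv_lhs => rw [h v, map_sum]
    rfl
  rw [finiteRankTrace, key, map_sum]
  refine Finset.sum_congr rfl fun c _ => ?_
  rw [LinearMap.trace_comp_comm']
  rfl

end Trace

/-! ### Haar measure with values in `k`. -/

section Measure

variable {k G V : Type*} [Field k] [Group G] [TopologicalSpace G] [AddCommGroup V] [Module k V]

namespace LeftHaarMeasure

variable (μ : LeftHaarMeasure k G)

theorem map_empty : μ.toFun ∅ = 0 := by
  have := μ.map_union ∅ ∅ isCompact_empty isOpen_empty isCompact_empty isOpen_empty (by simp)
  simpa using this

theorem map_biUnion {ι : Type*} (s : Finset ι) (A : ι → Set G)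
    (hc : ∀ i ∈ s, IsCompact (A i)) (ho : ∀ i ∈ s, IsOpen (A i))
    (hd : (s : Set ι).PairwiseDisjoint A) : μ.toFun (⋃ i ∈ s, A i) = ∑ i ∈ s, μ.toFun (A i) := by
  classical
  induction s using Finset.induction_on with
  | empty => simpa using μ.map_empty
  | insert a s ha ih =>
    rw [Finset.set_biUnion_insert, Finset.sum_insert ha, μ.map_union, ih]
    · exact fun i hi => hc i (Finset.mem_insert_of_mem hi)
    · exact fun i hi => ho i (Finset.mem_insert_of_mem hi)
    · exact hd.subset (by simp)
    · exact hc a (Finset.mem_insert_self a s)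
    · exact ho a (Finset.mem_insert_self a s)
    · exact s.isCompact_biUnion fun i hi => hc i (Finset.mem_insert_of_mem hi)
    · exact isOpen_biUnion fun i hi => ho i (Finset.mem_insert_of_mem hi)
    · refine Set.disjoint_iUnion₂_right.2 fun i hi => hd (by simp) (by simp [hi]) ?_
      rintro rfl
      exact ha hi

variable [IsTopologicalGroup G]

/-- A compact set meets only finitely many left cosets of an open subgroup. -/
theorem finite_image_mk_left {K : Subgroup G} (hK : IsOpen (K : Set G)) {A : Set G}
    (hA : IsCompact A) : ((QuotientGroup.mk : G → G ⧸ K) '' A).Finite := by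
  have := QuotientGroup.discreteTopology hK
  exact (hA.image QuotientGroup.continuous_mk).finite_of_discrete

/-- The measure of a compact set which is right invariant under `K` is `μ K` times the number of
left cosets in it. -/
theorem toFun_eq_card_mul {K : Subgroup G} (hK : IsOpen (K : Set G)) (hKc : IsCompact (K : Set G))
    (s : Finset (G ⧸ K)) :
    μ.toFun ((QuotientGroup.mk : G → G ⧸ K) ⁻¹' s) = s.card * μ.toFun K := by
  have hA : (QuotientGroup.mk : G → G ⧸ K) ⁻¹' s = ⋃ q ∈ s, q.out • (K : Set G) := by
    ext x
    simp only [Set.mem_preimage, Set.mem_iUnion, SetLike.mem_coe, Set.mem_smul_set_iff_inv_smul_mem,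
      smul_eq_mul, exists_prop]
    constructor
    · exact fun hx => ⟨_, hx, QuotientGroup.eq.1 (by simp)⟩
    · rintro ⟨q, hq, hx⟩
      rwa [← QuotientGroup.eq.2 hx, QuotientGroup.out_eq']
  rw [hA, μ.map_biUnion]
  · simp [μ.map_smul _ _ hKc hK]
  · exact fun q _ => hKc.smul _
  · exact fun q _ => hK.smul _
  · intro q _ r _ hqr
    refine Set.disjoint_left.2 fun x hx hx' => hqr ?_
    rw [Set.mem_smul_set_iff_inv_smul_mem] at hx hx'
    rw [← QuotientGroup.out_eq' q, ← QuotientGroup.out_eq' r]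
    exact (QuotientGroup.eq.2 hx).trans (QuotientGroup.eq.2 hx').symm

/-- A compact open set which is right invariant under `K` is the preimage of a finite set of left
cosets. -/
theorem exists_finset_eq_preimage {K : Subgroup G} (hK : IsOpen (K : Set G)) {A : Set G}
    (hA : IsCompact A) (hAK : ∀ x ∈ A, ∀ u ∈ K, x * u ∈ A) :
    ∃ s : Finset (G ⧸ K), (s : Set (G ⧸ K)) = QuotientGroup.mk '' A ∧
      A = (QuotientGroup.mk : G → G ⧸ K) ⁻¹' s := by
  refine ⟨(finite_image_mk_left hK hA).toFinset, by simp, ?_⟩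
  rw [Set.Finite.coe_toFinset]
  refine (Set.subset_preimage_image _ _).antisymm ?_
  rintro x ⟨y, hy, hyx⟩
  simpa using hAK y hy _ (QuotientGroup.eq.1 hyx)

/-- The integral of a right `K`-invariant function over a union of left cosets of `K` is a finite
sum over these cosets. -/
theorem integral_eq_sum {K : Subgroup G} (hK : IsOpen (K : Set G)) (hKc : IsCompact (K : Set G))
    (s : Finset (G ⧸ K)) (φ : G → V) (hφ : ∀ x, ∀ u ∈ K, φ (x * u) = φ x) :
    μ.integral ((QuotientGroup.mk : G → G ⧸ K) ⁻¹' s) φ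
      = μ.toFun K • ∑ q ∈ s, φ q.out := by
  classical
  have hout : ∀ x : G, φ (QuotientGroup.mk x : G ⧸ K).out = φ x := fun x => by
    obtain ⟨u, hu⟩ := QuotientGroup.mk_out_eq_mul K x
    rw [hu, hφ x u u.2]
  have hset : ∀ w : V, ((QuotientGroup.mk : G → G ⧸ K) ⁻¹' s) ∩ φ ⁻¹' {w}
      = (QuotientGroup.mk : G → G ⧸ K) ⁻¹' (s.filter fun q => φ q.out = w : Finset (G ⧸ K)) := by
    intro w
    ext x
    simp [hout]
  simp only [integral, hset, μ.toFun_eq_card_mul hK hKc]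
  rw [finsum_eq_sum_of_support_subset (s := s.image fun q => φ q.out)]
  · rw [Finset.smul_sum, ← Finset.sum_fiberwise_of_maps_to
      (s := s) (t := s.image fun q => φ q.out) (g := fun q : G ⧸ K => φ q.out)
      fun q hq => Finset.mem_image_of_mem _ hq]
    refine Finset.sum_congr rfl fun w _ => ?_
    rw [Finset.sum_congr rfl (g := fun _ => μ.toFun K • w)
      fun q hq => by rw [(Finset.mem_filter.1 hq).2], Finset.sum_const, mul_smul,
      Nat.cast_smul_eq_nsmul]
  · intro w hw
    rw [Finset.mem_coe, Finset.mem_image]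
    by_contra hne
    push Not at hne
    refine hw ?_
    simp [Finset.filter_false_of_mem hne]

/-- The measure of a compact open subgroup is nonzero. -/
theorem toFun_subgroup_ne_zero [CharZero k] [T2Space G] [LocallyCompactSpace G]
    [TotallyDisconnectedSpace G] {N : Subgroup G} (hN : IsOpen (N : Set G))
    (hNc : IsCompact (N : Set G)) : μ.toFun N ≠ 0 := by
  obtain ⟨A, hA, hAo, hμA⟩ := μ.exists_ne_zero
  -- Left stability of `A⁻¹` is right stability of `A`, which makes `A` a union of left cosets of a
  -- small `K`.
  set S := MulAction.stabilizer G A⁻¹ with hS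
  have hSo : IsOpen (S : Set G) := isOpen_stabilizer_of_isCompact hA.inv hAo.inv
  obtain ⟨K, hK, hKc, hKs⟩ := exists_compact_open_subgroup_subset (hN.inter hSo)
    ⟨one_mem _, one_mem _⟩
  have hAK : ∀ x ∈ A, ∀ u ∈ K, x * u ∈ A := by
    intro x hx u hu
    have hu' : u⁻¹ • A⁻¹ = A⁻¹ := MulAction.mem_stabilizer_iff.1 (inv_mem (hKs hu).2)
    have : u⁻¹ * x⁻¹ ∈ A⁻¹ := by
      rw [← hu']
      exact Set.smul_mem_smul_set (Set.inv_mem_inv.2 hx)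
    simpa using this
  obtain ⟨s, -, hs⟩ := exists_finset_eq_preimage hK hA hAK
  obtain ⟨t, ht, hNt⟩ := exists_finset_eq_preimage hK hNc
    fun x hx u hu => N.mul_mem hx (hKs hu).1
  have hμK : μ.toFun K ≠ 0 := by
    intro h0
    rw [hs, μ.toFun_eq_card_mul hK hKc, h0, mul_zero] at hμA
    exact hμA rfl
  rw [hNt, μ.toFun_eq_card_mul hK hKc]
  -- Characteristic zero keeps the number of cosets of `K` in `N` from vanishing in `k`.
  refine mul_ne_zero (Nat.cast_ne_zero.2 (Finset.card_ne_zero.2 ?_)) hμK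
  rw [← Finset.coe_nonempty, ht]
  exact ⟨_, 1, one_mem N, rfl⟩

end LeftHaarMeasure

end Measure

/-! ### Integrating a smooth representation over a compact open subgroup. -/

section SmoothOperators

variable {k G V : Type*} [Field k] [Group G] [TopologicalSpace G] [AddCommGroup V] [Module k V]
  [IsTopologicalGroup G]

/-- The sum over a finite set of left cosets expressing `∫_{z ∈ N} π (g z) v` for a vector fixed
by a small subgroup. -/
theorem integral_representation_eq_sum (μ : LeftHaarMeasure k G) (π : Representation k G V)
    {K N : Subgroup G} (hK : IsOpen (K : Set G)) (hKc : IsCompact (K : Set G))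
    {s : Finset (G ⧸ K)} (hs : (N : Set G) = (QuotientGroup.mk : G → G ⧸ K) ⁻¹' s) (g : G) {v : V}
    (hv : ∀ u ∈ K, π u v = v) :
    μ.integral (N : Set G) (fun z => π (g * z) v) = μ.toFun K • ∑ q ∈ s, π (g * q.out) v := by
  rw [hs]
  refine μ.integral_eq_sum hK hKc s _ fun x u hu => ?_
  rw [← mul_assoc, map_mul, Module.End.mul_apply, hv u hu]

omit [TopologicalSpace G] [IsTopologicalGroup G] in
/-- The sum of the translates of a `K`-fixed vector over the left cosets of `K` in `N` is fixed
by `N`. -/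
theorem sum_translates_mem_invariants (π : Representation k G V) {K N : Subgroup G}
    {s : Finset (G ⧸ K)} (hs : (N : Set G) = (QuotientGroup.mk : G → G ⧸ K) ⁻¹' s) {v : V}
    (hv : ∀ u ∈ K, π u v = v) :
    ∑ q ∈ s, π q.out v ∈ Representation.invariants (π.comp N.subtype) := by
  rw [Representation.mem_invariants]
  rintro ⟨u, hu⟩
  change π u _ = _
  rw [map_sum]
  refine Finset.sum_equiv (MulAction.toPerm u) (fun q => ?_) fun q _ => ?_
  · induction q using QuotientGroup.induction_on with
    | H x =>
      rw [← Finset.mem_coe, ← Finset.mem_coe, ← Set.mem_preimage, ← hs, MulAction.toPerm_apply,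
        MulAction.Quotient.smul_coe, ← Set.mem_preimage (f := QuotientGroup.mk), ← hs]
      simp [N.mul_mem_cancel_left hu]
  -- Translation by `u` permutes the cosets but not their chosen representatives; the discrepancy
  -- lies in `K`, which fixes `v`.
  · have : (u * q.out)⁻¹ * ((MulAction.toPerm u) q).out ∈ K := by
      rw [← QuotientGroup.eq, QuotientGroup.out_eq', MulAction.toPerm_apply,
        ← smul_eq_mul, ← MulAction.Quotient.smul_coe, QuotientGroup.out_eq']
    rw [← Module.End.mul_apply, ← map_mul]
    conv_lhs => rw [← hv _ this, ← Module.End.mul_apply, ← map_mul, mul_inv_cancel_left]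

variable [T2Space G] [LocallyCompactSpace G] [TotallyDisconnectedSpace G]

/-- Two vectors are treated at once so that their integrals become sums over the same cosets, which
gives additivity. -/
theorem exists_compact_open_subgroup_fixing {π : Representation k G V} (hπ : IsSmooth π)
    {N : Subgroup G} (hN : IsOpen (N : Set G)) (hNc : IsCompact (N : Set G)) (v w : V) :
    ∃ K : Subgroup G, IsOpen (K : Set G) ∧ IsCompact (K : Set G) ∧
      (∃ s : Finset (G ⧸ K), (N : Set G) = (QuotientGroup.mk : G → G ⧸ K) ⁻¹' s) ∧
      (∀ u ∈ K, π u v = v) ∧ ∀ u ∈ K, π u w = w := by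
  obtain ⟨A, hA, hAv⟩ := hπ v
  obtain ⟨B, hB, hBw⟩ := hπ w
  obtain ⟨K, hK, hKc, hKs⟩ := exists_compact_open_subgroup_subset (hN.inter (hA.inter hB))
    ⟨one_mem _, one_mem _, one_mem _⟩
  obtain ⟨s, -, hs⟩ := LeftHaarMeasure.exists_finset_eq_preimage hK hNc
    fun x hx u hu => N.mul_mem hx (hKs hu).1
  exact ⟨K, hK, hKc, ⟨s, hs⟩, fun u hu => hAv u (hKs hu).2.1, fun u hu => hBw u (hKs hu).2.2⟩

/-- The operator `∫_{z ∈ N} π (g z) dμ(z)` attached to a smooth representation `π`. -/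
noncomputable def integralOperator (μ : LeftHaarMeasure k G) {π : Representation k G V}
    (hπ : IsSmooth π) {N : Subgroup G} (hN : IsOpen (N : Set G)) (hNc : IsCompact (N : Set G))
    (g : G) :
    V →ₗ[k] V where
  toFun v := μ.integral (N : Set G) (fun z => π (g * z) v)
  map_add' v w := by
    obtain ⟨K, hK, hKc, ⟨s, hs⟩, hv, hw⟩ := exists_compact_open_subgroup_fixing hπ hN hNc v w
    rw [integral_representation_eq_sum μ π hK hKc hs g hv,
      integral_representation_eq_sum μ π hK hKc hs g hw,
      integral_representation_eq_sum μ π hK hKc hs g (v := v + w)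
        fun u hu => by rw [map_add, hv u hu, hw u hu]]
    simp [Finset.sum_add_distrib]
  map_smul' c v := by
    obtain ⟨K, hK, hKc, ⟨s, hs⟩, hv, -⟩ := exists_compact_open_subgroup_fixing hπ hN hNc v v
    rw [integral_representation_eq_sum μ π hK hKc hs g hv,
      integral_representation_eq_sum μ π hK hKc hs g (v := c • v)
        fun u hu => by rw [map_smul, hv u hu]]
    simp only [map_smul, ← Finset.smul_sum, RingHom.id_apply]
    rw [smul_comm]

variable (μ : LeftHaarMeasure k G) {π : Representation k G V}
  {N : Subgroup G} (hN : IsOpen (N : Set G)) (hNc : IsCompact (N : Set G)) (g : G)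

/-- Averaging over `N` produces `N`-invariant vectors, so the range lies in the image under `π g` of
a finite dimensional space. -/
theorem finiteDimensional_range_integralOperator (hπ : IsAdmissible π) :
    FiniteDimensional k (LinearMap.range (integralOperator μ hπ.1 hN hNc g)) := by
  have := hπ.2 N hN hNc
  refine Submodule.finiteDimensional_of_le
    (S₂ := (Representation.invariants (π.comp N.subtype)).map (π g)) ?_
  rintro _ ⟨v, rfl⟩
  obtain ⟨K, hK, hKc, ⟨s, hs⟩, hv, -⟩ := exists_compact_open_subgroup_fixing hπ.1 hN hNc v v
  have : integralOperator μ hπ.1 hN hNc g v = π g (μ.toFun K • ∑ q ∈ s, π q.out v) := by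
    change μ.integral _ _ = _
    rw [integral_representation_eq_sum μ π hK hKc hs g hv]
    simp
  rw [this]
  exact Submodule.mem_map_of_mem
    (Submodule.smul_mem _ _ (sum_translates_mem_invariants π hs hv))

/-- A linear map which is constant on the translates `π (g z) v`, `z ∈ N`, takes `μ N` times this
value on the integral. -/
theorem map_integralOperator_of_forall_eq (hπ : IsSmooth π) {W : Type*} [AddCommGroup W]
    [Module k W] (l : V →ₗ[k] W) {v : V} {w : W} (h : ∀ z ∈ N, l (π (g * z) v) = w) :
    l (integralOperator μ hπ hN hNc g v) = μ.toFun N • w := by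
  obtain ⟨K, hK, hKc, ⟨s, hs⟩, hv, -⟩ := exists_compact_open_subgroup_fixing hπ hN hNc v v
  change l (μ.integral _ _) = _
  rw [integral_representation_eq_sum μ π hK hKc hs g hv, map_smul, map_sum,
    Finset.sum_congr rfl (g := fun _ => w), hs, μ.toFun_eq_card_mul hK hKc, Finset.sum_const,
    ← Nat.cast_smul_eq_nsmul k, smul_smul, mul_comm]
  intro q hq
  refine h _ ?_
  rw [← SetLike.mem_coe (p := N), hs]
  simpa using hq

end SmoothOperators

/-! ### Diagonal blocks of the compactly induced representation. -/

section CompactInduction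

variable {k G W : Type*} [Field k] [Group G] [TopologicalSpace G] [IsTopologicalGroup G]
  [AddCommGroup W] [Module k W] {J : Subgroup G} {σ : Representation k J W}

/-- A smooth finite dimensional representation is trivial on an open subgroup. -/
theorem exists_isOpen_le_ker [FiniteDimensional k W] (hJ : IsOpen (J : Set G))
    (hσ : IsSmooth σ) :
    ∃ K : Subgroup G, IsOpen (K : Set G) ∧ ∀ u ∈ K, ∃ h : u ∈ J, σ ⟨u, h⟩ = 1 := by
  let b := Module.finBasis k W
  choose U hU hUb using fun i => hσ (b i)
  have hker : IsOpen (σ.ker : Set J) := by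
    refine Subgroup.isOpen_mono (H₁ := ⨅ i, U i) (fun u hu => ?_) ?_
    · rw [MonoidHom.mem_ker]
      exact b.ext fun i => hUb i u (Subgroup.mem_iInf.1 hu i)
    · rw [Subgroup.coe_iInf]
      exact isOpen_iInter_of_finite hU
  refine ⟨σ.ker.map J.subtype, hJ.isOpenMap_subtype_val _ hker, ?_⟩
  rintro _ ⟨u, hu, rfl⟩
  exact ⟨u.2, hu⟩

open Classical in
/-- The function supported on the coset `J x` with value `w` at `x`. -/
noncomputable def cosetFunction (σ : Representation k J W) (x : G) (w : W) (y : G) : W :=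
  if h : y * x⁻¹ ∈ J then σ ⟨y * x⁻¹, h⟩ w else 0

omit [TopologicalSpace G] [IsTopologicalGroup G] in
theorem cosetFunction_of_mem {x y : G} (h : y * x⁻¹ ∈ J) (w : W) :
    cosetFunction σ x w y = σ ⟨y * x⁻¹, h⟩ w := dif_pos h

omit [TopologicalSpace G] [IsTopologicalGroup G] in
theorem cosetFunction_of_notMem {x y : G} (h : y * x⁻¹ ∉ J) (w : W) :
    cosetFunction σ x w y = 0 := dif_neg h

/-- Since `yux⁻¹ = yx⁻¹ · xux⁻¹`, the function is right invariant under `x⁻¹Kx`. -/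
theorem cosetFunction_mem_cIndSpace {K : Subgroup G} (hK : IsOpen (K : Set G))
    (hKσ : ∀ u ∈ K, ∃ h : u ∈ J, σ ⟨u, h⟩ = 1) (x : G) (w : W) :
    cosetFunction σ x w ∈ cIndSpace J σ := by
  refine ⟨fun j y => ?_, ⟨K.comap (MulAut.conj x).toMonoidHom, ?_, fun y u hu => ?_⟩,
    {x}, isCompact_singleton, fun y hy => ?_⟩
  · by_cases h : y * x⁻¹ ∈ J
    · have h' : (j : G) * y * x⁻¹ ∈ J := by
        rw [mul_assoc]
        exact J.mul_mem j.2 h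
      rw [cosetFunction_of_mem h, cosetFunction_of_mem h', ← Module.End.mul_apply, ← map_mul]
      congr 2
      exact Subtype.ext (mul_assoc _ _ _)
    · have h' : (j : G) * y * x⁻¹ ∉ J := by
        rwa [mul_assoc, J.mul_mem_cancel_left j.2]
      rw [cosetFunction_of_notMem h, cosetFunction_of_notMem h', map_zero]
  · exact hK.preimage (f := fun u => x * u * x⁻¹) (by fun_prop)
  · obtain ⟨huJ, hσu⟩ := hKσ (x * u * x⁻¹) hu
    have heq : y * u * x⁻¹ = y * x⁻¹ * (x * u * x⁻¹) := by group
    by_cases h : y * x⁻¹ ∈ J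
    · have h' : y * u * x⁻¹ ∈ J := heq ▸ J.mul_mem h huJ
      have : (⟨y * u * x⁻¹, h'⟩ : J) = ⟨y * x⁻¹, h⟩ * ⟨x * u * x⁻¹, huJ⟩ := Subtype.ext heq
      rw [cosetFunction_of_mem h, cosetFunction_of_mem h', this, map_mul, hσu, mul_one]
    · have h' : y * u * x⁻¹ ∉ J := by
        rwa [heq, J.mul_mem_cancel_right huJ]
      rw [cosetFunction_of_notMem h, cosetFunction_of_notMem h']
  · by_contra hne
    refine hy (cosetFunction_of_notMem (fun h => hne ?_) w)
    exact ⟨y * x⁻¹, h, x, rfl, by simp⟩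

/-- The embedding of `W` into the compactly induced space as the functions supported on `J x`. -/
noncomputable def cosetEmbedding {K : Subgroup G} (hK : IsOpen (K : Set G))
    (hKσ : ∀ u ∈ K, ∃ h : u ∈ J, σ ⟨u, h⟩ = 1) (x : G) : W →ₗ[k] cIndSpace J σ where
  toFun w := ⟨cosetFunction σ x w, cosetFunction_mem_cIndSpace hK hKσ x w⟩
  map_add' v w := by
    ext y
    by_cases h : y * x⁻¹ ∈ J <;> simp [cosetFunction, h]
  map_smul' c w := by
    ext y
    by_cases h : y * x⁻¹ ∈ J <;> simp [cosetFunction, h]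

/-- Evaluation at a point on the compactly induced space. -/
noncomputable def cIndEval (σ : Representation k J W) (x : G) : cIndSpace J σ →ₗ[k] W :=
  LinearMap.proj x ∘ₗ (cIndSpace J σ).subtype

/-- A function in the compactly induced space is nonzero on finitely many right cosets. -/
theorem finite_support_cosets (hJ : IsOpen (J : Set G)) (f : cIndSpace J σ) :
    (Quotient.mk (QuotientGroup.rightRel J) '' Function.support (f : G → W)).Finite := by
  obtain ⟨-, -, C, hC, hs⟩ := f.2
  refine (finite_image_mk_of_isCompact hJ hC).subset ?_
  rintro _ ⟨x, hx, rfl⟩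
  obtain ⟨j, hj, c, hc, rfl⟩ := hs hx
  exact ⟨c, hc, Quotient.sound (QuotientGroup.rightRel_apply.2 (by simpa using hj))⟩

/-- A function in the compactly induced space is the sum of its restrictions to the right cosets
on which it is nonzero. -/
theorem eq_sum_cosetEmbedding {K : Subgroup G} (hK : IsOpen (K : Set G))
    (hKσ : ∀ u ∈ K, ∃ h : u ∈ J, σ ⟨u, h⟩ = 1) (f : cIndSpace J σ)
    (s : Finset (Quotient (QuotientGroup.rightRel J)))
    (hs : Quotient.mk (QuotientGroup.rightRel J) '' Function.support (f : G → W) ⊆ s) :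
    f = ∑ c ∈ s, cosetEmbedding hK hKσ c.out (cIndEval σ c.out f) := by
  ext y
  rw [Submodule.coe_sum, Finset.sum_apply]
  set q : Quotient (QuotientGroup.rightRel J) := Quotient.mk _ y with hq
  have hout : y * q.out⁻¹ ∈ J := QuotientGroup.rightRel_apply.1 (Quotient.mk_out y)
  have hterm : cosetFunction σ q.out ((f : G → W) q.out) y = (f : G → W) y := by
    rw [cosetFunction_of_mem hout, ← f.2.1]
    simp
  refine Eq.trans ?_ (Finset.sum_eq_single q (fun c _ hc => ?_) fun hqs => ?_).symm
  · exact hterm.symm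
  · refine cosetFunction_of_notMem (fun h => hc ?_) _
    rw [hq, ← Quotient.out_eq c]
    exact Quotient.sound (QuotientGroup.rightRel_apply.2 h)
  · change cosetFunction σ q.out ((f : G → W) q.out) y = 0
    rw [hterm]
    by_contra hy
    exact hqs (hs ⟨y, hy, rfl⟩)

/-- For a good element `g` the right cosets fixed by `g` and the operators `σ (x g x⁻¹)` do not
change if `g` is multiplied by an element of a small compact open subgroup. -/
theorem exists_compact_open_subgroup_fixedCosets_eq [T2Space G] [LocallyCompactSpace G]
    [TotallyDisconnectedSpace G] {K : Subgroup G}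
    (hK : IsOpen (K : Set G)) (hKJ : K ≤ J) {g : G} (hg : IsGoodElement J g) {N' : Subgroup G}
    (hN' : IsOpen (N' : Set G)) :
    ∃ N : Subgroup G, N ≤ N' ∧ IsOpen (N : Set G) ∧ IsCompact (N : Set G) ∧
      ∀ z ∈ N, fixedCosets J (g * z) = fixedCosets J g ∧
        ∀ c ∈ fixedCosets J g, c.out * z * c.out⁻¹ ∈ K := by
  obtain ⟨-, hfin, U, hU, hgU, hconst⟩ := hg
  have hF : (fixedCosets J g).Finite := Set.encard_lt_top_iff.1 hfin
  have hopen : IsOpen ((N' : Set G) ∩ ((fun z => g * z) ⁻¹' U ∩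
      ⋂ c ∈ fixedCosets J g, {z | c.out * z * c.out⁻¹ ∈ K})) :=
    hN'.inter ((hU.preimage (by fun_prop)).inter
      (hF.isOpen_biInter fun c _ => isOpen_setOf_conj_mem hK c.out))
  obtain ⟨N, hN, hNc, hNs⟩ := exists_compact_open_subgroup_subset hopen
    ⟨one_mem _, by simpa using hgU, by simp⟩
  refine ⟨N, fun z hz => (hNs hz).1, hN, hNc, fun z hz => ?_⟩
  have hzK : ∀ c ∈ fixedCosets J g, c.out * z * c.out⁻¹ ∈ K :=
    fun c hc => Set.mem_iInter₂.1 (hNs hz).2.2 c hc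
  have hcard := hconst (g * z) (hNs hz).2.1
  -- Only one inclusion is checked by hand; equality of the finite cardinalities, from constancy of
  -- `n_J`, gives the other.
  refine ⟨(hF.eq_of_subset_of_encard_le ?_ hcard.le).symm, hzK⟩
  intro c hc
  have h1 := mem_fixedCosets_iff.1 hc
  rw [mem_fixedCosets_iff]
  have : c.out * (g * z) * c.out⁻¹ = (c.out * g * c.out⁻¹) * (c.out * z * c.out⁻¹) := by group
  rw [this]
  exact J.mul_mem h1 (hKJ (hzK c hc))

omit [TopologicalSpace G] [IsTopologicalGroup G] in
theorem frobeniusSum_eq_sum (σ : Representation k J W) {g : G}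
    (s : Finset (Quotient (QuotientGroup.rightRel J))) (hs : fixedCosets J g ⊆ s) :
    frobeniusSum J σ g = ∑ c ∈ s, conjTrace J σ g c.out := by
  have hlift : ∀ q : Quotient (QuotientGroup.rightRel J),
      Quotient.lift (conjTrace J σ g) (conjTrace_eq_of_rel J σ g) q = conjTrace J σ g q.out := by
    intro q
    conv_lhs => rw [← Quotient.out_eq q]
    rfl
  simp only [frobeniusSum, hlift]
  refine finsum_eq_sum_of_support_subset _ fun q hq => hs (mem_fixedCosets_iff.2 ?_)
  by_contra h
  exact hq (dif_neg h)

/-- The Frobenius formula for the character of a compactly induced representation near a good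
element. -/
theorem finiteRankTrace_cInd_eq_frobeniusSum [CharZero k] [T2Space G] [LocallyCompactSpace G]
    [TotallyDisconnectedSpace G] [FiniteDimensional k W] (hJ : IsOpen (J : Set G))
    (hσ : IsSmooth σ) (hρ : IsAdmissible (cInd J σ)) {g : G} (μ : LeftHaarMeasure k G)
    (hg : IsGoodElement J g) {N' : Subgroup G} (hN' : IsOpen (N' : Set G)) :
    ∃ N : Subgroup G, N ≤ N' ∧ IsOpen (N : Set G) ∧ IsCompact (N : Set G) ∧
      μ.toFun N ≠ 0 ∧
      ∃ T : cIndSpace J σ →ₗ[k] cIndSpace J σ,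
        (∀ f, T f = μ.integral (N : Set G) (fun z => cInd J σ (g * z) f)) ∧
        FiniteDimensional k (LinearMap.range T) ∧
        1 / μ.toFun N * finiteRankTrace T = frobeniusSum J σ g := by
  classical
  obtain ⟨K, hK, hKσ⟩ := exists_isOpen_le_ker hJ hσ
  obtain ⟨N, hNN', hN, hNc, hfix⟩ := exists_compact_open_subgroup_fixedCosets_eq hK
    (fun u hu => (hKσ u hu).1) hg hN'
  have hμ := μ.toFun_subgroup_ne_zero hN hNc
  set T := integralOperator μ hρ.1 hN hNc g with hT
  have hfd : FiniteDimensional k (LinearMap.range T) :=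
    finiteDimensional_range_integralOperator μ hN hNc g hρ
  refine ⟨N, hNN', hN, hNc, hμ, T, fun f => rfl, hfd, ?_⟩
  -- Finitely many functions span the range, so one finite set `s` of cosets carries the supports of
  -- all its elements. It is enlarged to contain the cosets fixed by `g`.
  obtain ⟨b, hb⟩ := (LinearMap.range T).fg_iff_finiteDimensional.2 hfd
  have hFb : (⋃ f ∈ b, Quotient.mk (QuotientGroup.rightRel J) ''
      Function.support (f : G → W)).Finite :=
    b.finite_toSet.biUnion fun f _ => finite_support_cosets hJ f
  have hFg : (fixedCosets J g).Finite := Set.encard_lt_top_iff.1 hg.2.1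
  obtain ⟨s, hs⟩ := (hFb.union hFg).exists_finset_coe
  have hrange : ∀ f ∈ LinearMap.range T,
      f = ∑ c ∈ s, cosetEmbedding hK hKσ c.out (cIndEval σ c.out f) := by
    intro f hf
    rw [← hb] at hf
    induction hf using Submodule.span_induction with
    | mem f hf =>
      refine eq_sum_cosetEmbedding hK hKσ f s ?_
      rw [hs]
      exact Set.subset_union_of_subset_left (Set.subset_biUnion_of_mem
        (u := fun f : cIndSpace J σ => Quotient.mk (QuotientGroup.rightRel J) '' Function.support (f : G → W)) hf) _
    | zero => simp
    | add f f' _ _ h h' =>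
      simp only [map_add, Finset.sum_add_distrib]
      rw [← h, ← h']
    | smul a f _ h =>
      simp only [map_smul, ← Finset.smul_sum]
      rw [← h]
  rw [finiteRankTrace_eq_sum_trace s T (fun c => cosetEmbedding hK hKσ c.out)
      (fun c => cIndEval σ c.out) fun f => hrange _ ⟨f, rfl⟩,
    frobeniusSum_eq_sum σ s (by rw [hs]; exact Set.subset_union_right), Finset.mul_sum]
  refine Finset.sum_congr rfl fun c _ => ?_
  by_cases hc : c.out * g * c.out⁻¹ ∈ J
  · have hblock : cIndEval σ c.out ∘ₗ T ∘ₗ cosetEmbedding hK hKσ c.out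
        = μ.toFun N • σ ⟨c.out * g * c.out⁻¹, hc⟩ := by
      ext w
      refine map_integralOperator_of_forall_eq μ hN hNc g hρ.1 (cIndEval σ c.out) fun z hz => ?_
      -- The integrand is the same for all `z ∈ N`, because `c.out * z * c.out⁻¹` acts trivially
      -- through `σ`.
      change cosetFunction σ c.out w (c.out * (g * z)) = _
      obtain ⟨hzJ, hσz⟩ := hKσ _ ((hfix z hz).2 c (mem_fixedCosets_iff.2 hc))
      have heq : c.out * (g * z) * c.out⁻¹ = (c.out * g * c.out⁻¹) * (c.out * z * c.out⁻¹) := by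
        group
      have h' : c.out * (g * z) * c.out⁻¹ ∈ J := heq ▸ J.mul_mem hc hzJ
      have : (⟨_, h'⟩ : J) = ⟨_, hc⟩ * ⟨_, hzJ⟩ := Subtype.ext heq
      rw [cosetFunction_of_mem h', this, map_mul, hσz, mul_one]
    rw [hblock, map_smul, smul_eq_mul, conjTrace, dif_pos hc, one_div, inv_mul_cancel_left₀ hμ]
  · have hblock : cIndEval σ c.out ∘ₗ T ∘ₗ cosetEmbedding hK hKσ c.out = 0 := by
      ext w
      refine (map_integralOperator_of_forall_eq μ hN hNc g hρ.1 (cIndEval σ c.out) (w := 0)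
        fun z hz => ?_).trans (smul_zero _)
      -- A coset not fixed by `g` is not fixed by any `gz`, so the integrand vanishes on all of `N`.
      refine cosetFunction_of_notMem (fun h => hc ?_) w
      rw [← mem_fixedCosets_iff, ← (hfix z hz).1, mem_fixedCosets_iff]
      exact h
    rw [hblock, map_zero, mul_zero, conjTrace, dif_neg hc]

end CompactInduction

end FrobChar

theorem theorem3p1 :
    (∀ (k : Type*) [Field k] [CharZero k]
      (G : Type*) [Group G] [TopologicalSpace G] [IsTopologicalGroup G]
      [T2Space G] [LocallyCompactSpace G] [TotallyDisconnectedSpace G]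
      (J : Subgroup G), FrobChar.IsOpenCompactModCenter J →
      ∀ (W : Type*) [AddCommGroup W] [Module k W] [FiniteDimensional k W]
      (σ : Representation k J W), FrobChar.IsSmooth σ →
      FrobChar.IsAdmissible (FrobChar.cInd J σ) →
      ∀ (g : G) (μ : FrobChar.LeftHaarMeasure k G), FrobChar.IsGoodElement J g →
      ∀ N' : Subgroup G, IsOpen (N' : Set G) →
      ∃ N : Subgroup G, N ≤ N' ∧ IsOpen (N : Set G) ∧ IsCompact (N : Set G) ∧
        μ.toFun N ≠ 0 ∧
        ∃ T : FrobChar.cIndSpace J σ →ₗ[k] FrobChar.cIndSpace J σ,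
          (∀ f, T f = μ.integral (N : Set G) (fun z => FrobChar.cInd J σ (g * z) f)) ∧
          FiniteDimensional k (LinearMap.range T) ∧
          1 / μ.toFun N * FrobChar.finiteRankTrace T = FrobChar.frobeniusSum J σ g) ∧
    (∀ (F : Type*) [NontriviallyNormedField F] [IsUltrametricDist F] [LocallyCompactSpace F]
      (n : ℕ),
      (T2Space (GL (Fin n) F) ∧ LocallyCompactSpace (GL (Fin n) F) ∧
        TotallyDisconnectedSpace (GL (Fin n) F)) ∧
      ∀ J : Subgroup (GL (Fin n) F), FrobChar.IsOpenCompactModCenter J →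
      ∀ g : GL (Fin n) F, FrobChar.IsRegularElliptic g → FrobChar.IsGoodElement J g) := by
  refine ⟨?_, ?_⟩
  · intro k _ _ G _ _ _ _ _ _ J hJ W _ _ _ σ hσ hρ g μ hg N' hN'
    exact FrobChar.finiteRankTrace_cInd_eq_frobeniusSum hJ.1 hσ hρ μ hg hN'
  · intro F _ _ _ n
    exact ⟨⟨inferInstance, FrobChar.locallyCompactSpace_GL F n,
      FrobChar.totallyDisconnectedSpace_GL F n⟩,
      fun J hJ g hg => FrobChar.isGoodElement_of_isRegularElliptic hg hJ⟩
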